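/- Let $\mathcal C$ be a small category. A presheaf on $\mathcal C$ means a (covariant) functor $K:\mathcal C\to\mathbf{Set}$, viewed as a many-sorted unary algebra with the objects of $\mathcal C$ as sorts and the arrows of $\mathcal C$ as unary function symbols; for an arrow $f: Z\to X$ and $c\in K(Z)$ write $f\cdot c=K(f)(c)\in K(X)$. A natural transformation $\eta:K\to L$ is a *pure monomorphism* if for every positive primitive formula $\varphi(x_1,\dots,x_n)$ (built from equations between terms by finite conjunctions and existential quantifiers) and all $a_1,\dots,a_n\in K$ of the appropriate sorts, $K\models\varphi(a_1,\dots,a_n)$ if and only if $L\models\varphi(\eta(a_1),\dots,\eta(a_n))$. Let $\mathbf{Set}^{\mathcal C}_{\mathrm{pure}}$ be the category of presheaves on $\mathcal C$ with the pure monomorphisms as arrows. A commutative square of pure monomorphisms with span $A\leftarrow C\to B$ and corner $D$ is *pure effective* if the induced arrow $A\sqcup_C B\to D$ from the pushout in $\mathbf{Set}^{\mathcal C}$ is a pure monomorphism. An *independence relation* on a category $\mathcal K$ is a class of commutative squares in $\mathcal K$ (called independent squares) that is invariant under isomorphism of squares and such that a commutative square $(C\to A\to D,\ C\to B\to D)$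 is independent if and only if $(C\to A\to D\to E,\ C\to B\to D\to E)$ is, for every arrow $D\to E$. It is *weakly stable* if it satisfies: symmetry (the transpose of an independent square is independent); existence (every span can be completed to an independent square); uniqueness (whenever two independent squares have the same span $A\leftarrow C\to B$, with corners $D$ and $D'$, there are arrows $D\to E\leftarrow D'$ making the two composites $A\to E$ equal and the two composites $B\to E$ equal); and transitivity (the outer rectangle of two adjacent independent squares is independent). It is *stable* if it is weakly stable and the category whose objects are the arrows of $\mathcal K$ and whose arrows are the independent squares is accessible (i.e. $\kappa$-accessible for some regular cardinal $\kappa$). A presheaf $K$ *interprets a complete bipartite graph* if there are arrows $f:Z\to X$ and $g:Z\to Y$ of $\mathcal C$ and infinite sets $A\subseteq K(X)$ and $B\subseteq K(Y)$ such that for all $a\in A$ and $b\in B$ there is $c\in K(Z)$ with $f\cdot c=a$ and $g\cdot c=b$. **Theorem.** If the pure effective squares form a stable independence relation on $\mathbf{Set}^{\mathcal C}_{\mathrm{pure}}$, then no presheaf on $\mathcal C$ interprets a complete bipartite graph. -/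

import Mathlib

open CategoryTheory CategoryTheory.Limits

universe w v u

/-! ### Independence relations on a category -/

namespace Independence

variable {K : Type u} [Category.{v} K]

/-- An independence relation on `K`: a class of commutative squares

```
C --> B
|     |
v     v
A --> D
```

that is invariant under isomorphism of squares, and such that a commutative square with corner `D`
belongs to the class if and only if its extension along any arrow `e : D ⟶ E` does. -/
class IsIndependenceRelation (R : ObjectProperty (Square K)) : Prop where
  of_iso : ∀ {s t : Square K}, (s ≅ t) → R s → R t
  extend_iff : ∀ {C B A D E : K} (cb : C ⟶ B) (ca : C ⟶ A) (bd : B ⟶ D) (ad : A ⟶ D)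
    (h : cb ≫ bd = ca ≫ ad) (e : D ⟶ E),
    R (Square.mk cb ca bd ad h) ↔
      R (Square.mk cb ca (bd ≫ e) (ad ≫ e) (by rw [← Category.assoc, h, Category.assoc]))

/-- Symmetry: the transpose of an independent square is independent. -/
class HasSymmetry (R : ObjectProperty (Square K)) : Prop where
  symm : ∀ s : Square K, R s → R s.flip

/-- Existence: every span can be completed to an independent square. -/
class HasExistence (R : ObjectProperty (Square K)) : Prop where
  exists_square : ∀ {C B A : K} (cb : C ⟶ B) (ca : C ⟶ A),
    ∃ (D : K) (bd : B ⟶ D) (ad : A ⟶ D) (h : cb ≫ bd = ca ≫ ad), R (Square.mk cb ca bd ad h)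

/-- Uniqueness: two independent squares on the same span can be amalgamated. -/
class HasUniqueness (R : ObjectProperty (Square K)) : Prop where
  amalgamate : ∀ {C B A D D' : K} (cb : C ⟶ B) (ca : C ⟶ A)
    (bd : B ⟶ D) (ad : A ⟶ D) (h : cb ≫ bd = ca ≫ ad)
    (bd' : B ⟶ D') (ad' : A ⟶ D') (h' : cb ≫ bd' = ca ≫ ad'),
    R (Square.mk cb ca bd ad h) → R (Square.mk cb ca bd' ad' h') →
      ∃ (E : K) (e : D ⟶ E) (e' : D' ⟶ E), bd ≫ e = bd' ≫ e' ∧ ad ≫ e = ad' ≫ e'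

/-- Transitivity: the outer rectangle of two adjacent independent squares is independent. -/
class HasTransitivity (R : ObjectProperty (Square K)) : Prop where
  paste : ∀ {C B A D A' D' : K} (cb : C ⟶ B) (ca : C ⟶ A) (bd : B ⟶ D) (ad : A ⟶ D)
    (aa' : A ⟶ A') (dd' : D ⟶ D') (ad' : A' ⟶ D')
    (h : cb ≫ bd = ca ≫ ad) (h' : ad ≫ dd' = aa' ≫ ad'),
    R (Square.mk cb ca bd ad h) → R (Square.mk ad aa' dd' ad' h') →
      R (Square.mk cb (ca ≫ aa') (bd ≫ dd') ad'
        (by rw [← Category.assoc, h, Category.assoc, h', Category.assoc]))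

/-- Weakly stable independence relations. -/
class IsWeaklyStable (R : ObjectProperty (Square K)) : Prop extends
  IsIndependenceRelation R, HasSymmetry R, HasUniqueness R, HasTransitivity R, HasExistence R

/-- The class of those arrows of the arrow category of `K` that are independent squares. -/
def indepArrows (R : ObjectProperty (Square K)) : MorphismProperty (Arrow K) :=
  fun f g φ => R (Square.mk f.hom φ.left φ.right g.hom (Arrow.w φ).symm)

instance (R : ObjectProperty (Square K)) [IsIndependenceRelation R] [HasExistence R]
    [HasTransitivity R] : (indepArrows R).IsMultiplicative where
  id_mem f := by
    obtain ⟨D, bd, ad, h, hR⟩ := HasExistence.exists_square (R := R) f.hom (𝟙 f.left)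
    have had : ad = f.hom ≫ bd := by simpa using h.symm
    subst had
    have := (IsIndependenceRelation.extend_iff (R := R) f.hom (𝟙 f.left) (𝟙 f.right) f.hom
      (by simp) bd).2 (by simpa using hR)
    exact this
  comp_mem φ ψ hφ hψ :=
    HasTransitivity.paste _ _ _ _ _ _ _ _ _ hφ hψ

/-- The category whose objects are the arrows of `K` and whose arrows are the independent
squares. -/
abbrev IndepCategory (R : ObjectProperty (Square K)) [IsIndependenceRelation R] [HasExistence R]
    [HasTransitivity R] : Type (max u v) :=
  WideSubcategory (indepArrows R)

/-- Stable independence relations: those that are weakly stable and accessible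
(with respect to the universe `w` of small sets). -/
class IsStable (R : ObjectProperty (Square K)) : Prop extends IsWeaklyStable R where
  accessible : IsAccessibleCategory.{w} (IndepCategory R)

end Independence

/-! ### Presheaves as many-sorted unary algebras -/

namespace Presheaf

variable {C : Type u} [SmallCategory C]

/-- Terms, in the signature with the objects of `C` as sorts and the arrows of `C` as unary
function symbols, in variables `x₀, …, xₙ₋₁` of sorts `Γ 0, …, Γ (n - 1)`;
`PPTerm Γ X` is the type of such terms of sort `X`. -/
inductive PPTerm {n : ℕ} (Γ : Fin n → C) : C → Type u
  | var (i : Fin n) : PPTerm Γ (Γ i)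
  | app {X Y : C} (f : X ⟶ Y) (t : PPTerm Γ X) : PPTerm Γ Y

/-- The value of a term in the (covariant) presheaf `K`. -/
def PPTerm.eval (K : C ⥤ Type u) {n : ℕ} {Γ : Fin n → C} (a : ∀ i, K.obj (Γ i)) :
    ∀ {X : C}, PPTerm Γ X → K.obj X
  | _, .var i => a i
  | _, .app f t => K.map f (t.eval K a)

/-- Positive primitive formulas with free variables of sorts `Γ 0, …, Γ (n - 1)`: they are built
from equations between terms of the same sort by (possibly empty) finite conjunctions and
existential quantifiers (over a variable of a given sort). -/
inductive PPFormula : {n : ℕ} → (Γ : Fin n → C) → Type u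
  | eq {n : ℕ} {Γ : Fin n → C} {X : C} (s t : PPTerm Γ X) : PPFormula Γ
  | top {n : ℕ} {Γ : Fin n → C} : PPFormula Γ
  | and {n : ℕ} {Γ : Fin n → C} (φ ψ : PPFormula Γ) : PPFormula Γ
  | ex {n : ℕ} {Γ : Fin n → C} (X : C) (φ : PPFormula (Fin.cons X Γ : Fin (n + 1) → C)) :
      PPFormula Γ

/-- Extend an assignment `a` of the variables of `Γ` by the value `x` of a new first variable. -/
def extendAssignment (K : C ⥤ Type u) {n : ℕ} {Γ : Fin n → C} {X : C} (x : K.obj X)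
    (a : ∀ i, K.obj (Γ i)) (i : Fin (n + 1)) : K.obj ((Fin.cons X Γ : Fin (n + 1) → C) i) :=
  Fin.cases (motive := fun i => K.obj ((Fin.cons X Γ : Fin (n + 1) → C) i)) x a i

/-- Truth of a positive primitive formula in the presheaf `K`. -/
def PPFormula.Realize (K : C ⥤ Type u) :
    ∀ {n : ℕ} {Γ : Fin n → C}, PPFormula Γ → (∀ i, K.obj (Γ i)) → Prop
  | _, _, .eq s t, a => s.eval K a = t.eval K a
  | _, _, .top, _ => True
  | _, _, .and φ ψ, a => φ.Realize K a ∧ ψ.Realize K a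
  | _, _, .ex X φ, a => ∃ x : K.obj X, φ.Realize K (extendAssignment K x a)

variable (C) in
/-- Pure monomorphisms of presheaves: the homomorphisms that preserve and reflect the truth of
positive primitive formulas. -/
def pureMono : MorphismProperty (C ⥤ Type u) :=
  fun K L η => ∀ (n : ℕ) (Γ : Fin n → C) (φ : PPFormula Γ) (a : ∀ i, K.obj (Γ i)),
    φ.Realize K a ↔ φ.Realize L (fun i => η.app (Γ i) (a i))

instance : (pureMono C).IsMultiplicative where
  id_mem _ := fun _ _ _ _ => Iff.rfl
  comp_mem f _ hf hg := fun n Γ φ a =>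
    (hf n Γ φ a).trans (hg n Γ φ fun i => f.app (Γ i) (a i))

variable (C) in
/-- The category of presheaves on `C` with the pure monomorphisms as arrows. -/
abbrev PureCategory : Type (u + 1) := WideSubcategory (pureMono C)

/-- A commutative square of presheaves is pure effective if the induced arrow from the pushout of
its span to its corner is a pure monomorphism. -/
def IsPureEffective {L₀ L₁ L₂ L : C ⥤ Type u} (f₁ : L₀ ⟶ L₁) (f₂ : L₀ ⟶ L₂) (g₁ : L₁ ⟶ L)
    (g₂ : L₂ ⟶ L) (h : f₁ ≫ g₁ = f₂ ≫ g₂) : Prop :=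
  pureMono C (pushout.desc g₁ g₂ h)

variable (C) in
/-- The pure effective squares: those commutative squares of pure monomorphisms for which the
induced arrow from the pushout (taken in the category of all presheaves) is a pure monomorphism. -/
def pureEffective : ObjectProperty (Square (PureCategory C)) :=
  fun s => IsPureEffective ((wideSubcategoryInclusion (pureMono C)).map s.f₁₂)
    ((wideSubcategoryInclusion (pureMono C)).map s.f₁₃)
    ((wideSubcategoryInclusion (pureMono C)).map s.f₂₄)
    ((wideSubcategoryInclusion (pureMono C)).map s.f₃₄)
    (s.map (wideSubcategoryInclusion (pureMono C))).fac

/-- `A` and `B` form an `(f, g)`-interpreted complete bipartite graph in the presheaf `K`. -/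
def IsInterpretedCompleteBipartite (K : C ⥤ Type u) {X Y Z : C} (f : Z ⟶ X) (g : Z ⟶ Y)
    (A : Set (K.obj X)) (B : Set (K.obj Y)) : Prop :=
  A.Infinite ∧ B.Infinite ∧ ∀ a ∈ A, ∀ b ∈ B, ∃ c : K.obj Z, K.map f c = a ∧ K.map g c = b

/-- The presheaf `K` interprets a complete bipartite graph. -/
def InterpretsCompleteBipartite (K : C ⥤ Type u) : Prop :=
  ∃ (X Y Z : C) (f : Z ⟶ X) (g : Z ⟶ Y) (A : Set (K.obj X)) (B : Set (K.obj Y)),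
    IsInterpretedCompleteBipartite K f g A B

end Presheaf

/-! ### Monotonicity of weakly stable independence -/

namespace Independence

variable {K : Type u} [Category.{v} K]

/-! Take distinct `a₀, a₁` in `A` and distinct `b₀, b₁` in `B`, and let `δ : K^I ⟶ (K^I)^2` be the
diagonal, with `I` larger than the `X`-sort of the domain of every arrow in a small set of
generators of the category of independent squares. Accessibility writes `δ` as a filtered colimit of
generators. The non-diagonal pair `b = (b₀, b₁)` of constant families comes from the codomain of
some generator `h` (`exists_right_app_eq`). Every family in `{a₀, a₁}^I` is linked to `b`,
coordinate by coordinate, so effectiveness of the square from `h` to `δ` forces it to come from the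
domain of `h` (`IsPureEffective.exists_preimage`). This gives `2^I` elements in a set no larger than
`I`, against Cantor. -/

/-- Independence is inherited by smaller objects on one side: if the square from `C` to `D` with
sides `A'` and `B` is independent and `C ⟶ A'` factors through `A`, then the square with sides `A`
and `B` is independent. -/
theorem IsWeaklyStable.monotone {R : ObjectProperty (Square K)} [IsWeaklyStable R]
    {C B A A' D : K} (cb : C ⟶ B) (ca : C ⟶ A) (aa' : A ⟶ A') (bd : B ⟶ D) (ad' : A' ⟶ D)
    (h : cb ≫ bd = (ca ≫ aa') ≫ ad') (h' : cb ≫ bd = ca ≫ aa' ≫ ad')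
    (hR : R (Square.mk cb (ca ≫ aa') bd ad' h)) :
    R (Square.mk cb ca bd (aa' ≫ ad') h') := by
  -- Two pasted squares complete the same span as `hR` and contain an independent square on `A` and
  -- `B`; uniqueness carries its independence over to `D`.
  obtain ⟨D₁, b₁, a₁, h₁, hR₁⟩ := HasExistence.exists_square (R := R) cb ca
  obtain ⟨D₂, d₂, a₂, h₂, hR₂⟩ := HasExistence.exists_square (R := R) a₁ aa'
  have hR₃ := HasTransitivity.paste _ _ _ _ _ _ _ h₁ h₂ hR₁ hR₂
  obtain ⟨E, e, e', hb, ha⟩ := HasUniqueness.amalgamate _ _ _ _ _ _ _ _ hR hR₃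
  have hR₄ := (IsIndependenceRelation.extend_iff _ _ _ _ h₁ (d₂ ≫ e')).1 hR₁
  refine (IsIndependenceRelation.extend_iff _ _ _ _ h' e).2 ?_
  have hb' : bd ≫ e = b₁ ≫ d₂ ≫ e' := by simpa using hb
  have ha' : (aa' ≫ ad') ≫ e = a₁ ≫ d₂ ≫ e' := by
    rw [Category.assoc, ha, ← Category.assoc, ← h₂, Category.assoc]
  convert hR₄

end Independence

/-! ### Positive primitive formulas and pure monomorphisms -/

namespace Presheaf

variable {C : Type u} [SmallCategory C]

theorem PPTerm.eval_map {K L : C ⥤ Type u} (η : K ⟶ L) {n : ℕ} {Γ : Fin n → C}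
    (a : ∀ i, K.obj (Γ i)) {X : C} (t : PPTerm Γ X) :
    η.app X (t.eval K a) = t.eval L (fun i => η.app (Γ i) (a i)) := by
  induction t with
  | var i => rfl
  | app f t ih =>
    simp only [PPTerm.eval]
    rw [← ih, NatTrans.naturality_apply]

theorem map_extendAssignment {K L : C ⥤ Type u} (η : K ⟶ L) {n : ℕ} {Γ : Fin n → C} {X : C}
    (x : K.obj X) (a : ∀ i, K.obj (Γ i)) :
    (fun i => η.app _ (extendAssignment K x a i)) =
      extendAssignment L (η.app X x) (fun i => η.app (Γ i) (a i)) := by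
  funext i
  induction i using Fin.cases <;> rfl

/-- Homomorphisms preserve the truth of positive primitive formulas. -/
theorem PPFormula.Realize.map {K L : C ⥤ Type u} (η : K ⟶ L) {n : ℕ} {Γ : Fin n → C}
    {φ : PPFormula Γ} {a : ∀ i, K.obj (Γ i)} (h : φ.Realize K a) :
    φ.Realize L (fun i => η.app (Γ i) (a i)) := by
  induction φ with
  | eq s t =>
    simp only [PPFormula.Realize] at h ⊢
    rw [← PPTerm.eval_map, ← PPTerm.eval_map, h]
  | top => trivial
  | and φ ψ ihφ ihψ => exact ⟨ihφ h.1, ihψ h.2⟩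
  | ex X φ ih =>
    obtain ⟨x, hx⟩ := h
    exact ⟨η.app X x, map_extendAssignment η x a ▸ ih hx⟩

/-- Preservation is automatic, and truth in `L` is pushed on to `M` before being reflected to `K`.
-/
theorem pureMono.of_comp {K L M : C ⥤ Type u} {f : K ⟶ L} {g : L ⟶ M}
    (h : pureMono C (f ≫ g)) : pureMono C f :=
  fun n Γ φ a => ⟨fun hφ => hφ.map f, fun hφ => (h n Γ φ a).2 (hφ.map g)⟩

/-- A homomorphism that is pure on a family of homomorphisms into its source, through which all
finite assignments factor, is pure. -/
theorem pureMono.of_exists_lift {K M : C ⥤ Type u} (θ : K ⟶ M)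
    (h : ∀ (n : ℕ) (Γ : Fin n → C) (a : ∀ i, K.obj (Γ i)), ∃ (L : C ⥤ Type u) (l : L ⟶ K)
      (b : ∀ i, L.obj (Γ i)), pureMono C (l ≫ θ) ∧ ∀ i, l.app (Γ i) (b i) = a i) :
    pureMono C θ := by
  refine fun n Γ φ a => ⟨fun hφ => hφ.map θ, fun hφ => ?_⟩
  obtain ⟨L, l, b, hl, hb⟩ := h n Γ a
  obtain rfl : (fun i => l.app (Γ i) (b i)) = a := funext hb
  exact ((hl n Γ φ b).2 hφ).map l

theorem pureMono.of_split {K L : C ⥤ Type u} {f : K ⟶ L} {r : L ⟶ K} (h : f ≫ r = 𝟙 K) :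
    pureMono C f :=
  pureMono.of_comp (g := r) (h ▸ MorphismProperty.id_mem _ _)

/-- Reflection of the formula `∃ z, f z = x ∧ g z = y` along a pure monomorphism. -/
theorem pureMono.exists_link {K L : C ⥤ Type u} {η : K ⟶ L} (h : pureMono C η) {X Y Z : C}
    (f : Z ⟶ X) (g : Z ⟶ Y) (x : K.obj X) (y : K.obj Y) (z : L.obj Z)
    (hx : L.map f z = η.app X x) (hy : L.map g z = η.app Y y) :
    ∃ z : K.obj Z, K.map f z = x ∧ K.map g z = y := by
  let Γ : Fin 2 → C := Fin.cons X (Fin.cons Y Fin.elim0)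
  let a : ∀ i, K.obj (Γ i) := extendAssignment K x (extendAssignment K y (fun i => i.elim0))
  let Δ : Fin 3 → C := Fin.cons Z Γ
  let z₀ : PPTerm Δ Z := PPTerm.var (Γ := Δ) 0
  let x₀ : PPTerm Δ X := PPTerm.var (Γ := Δ) 1
  let y₀ : PPTerm Δ Y := PPTerm.var (Γ := Δ) 2
  exact (h 2 Γ (.ex Z (.and (.eq (.app f z₀) x₀) (.eq (.app g z₀) y₀))) a).2 ⟨z, hx, hy⟩

/-- Equality is the link formula for `f = g = 𝟙 X`. -/
theorem pureMono.injective {K L : C ⥤ Type u} {η : K ⟶ L} (h : pureMono C η) (X : C) :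
    Function.Injective (η.app X) := by
  intro x y hxy
  obtain ⟨z, rfl, rfl⟩ := h.exists_link (𝟙 X) (𝟙 X) x y (η.app X x) (by simp) (by simpa using hxy)
  rfl

theorem PureCategory.hom_injective {K L : PureCategory C} (η : K ⟶ L) (X : C) :
    Function.Injective (η.hom.app X) :=
  pureMono.injective η.property X

theorem PureCategory.hom_ext_app {K L : PureCategory C} {η θ : K ⟶ L}
    (h : ∀ (X : C) (x : K.obj.obj X), η.hom.app X x = θ.hom.app X x) : η = θ := by
  apply WideSubcategory.hom_ext
  ext X x
  exact h X x

instance {K L : PureCategory C} (η : K ⟶ L) : Mono η where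
  right_cancellation α β h := PureCategory.hom_ext_app fun X x => by
    apply PureCategory.hom_injective η X
    exact ConcreteCategory.congr_hom (congr_app (congrArg (fun θ => θ.hom) h) X) x

/-! ### Filtered colimits of independent squares -/

/-- The union of the images of a filtered cocone of pure monomorphisms. -/
theorem PureCategory.exists_union {J : Type*} [Category J] [IsFiltered J]
    {D : J ⥤ PureCategory C} (c : Cocone D) :
    ∃ (U : PureCategory C) (ι : U ⟶ c.pt) (l : ∀ j, D.obj j ⟶ U),
      (∀ j, l j ≫ ι = c.ι.app j) ∧
      (∀ (X : C) (u : U.obj.obj X), ∃ (j : J) (x : (D.obj j).obj.obj X), (l j).hom.app X x = u) ∧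
      ∀ (T : PureCategory C) (f : T ⟶ c.pt),
        (∀ (X : C) (t : T.obj.obj X), ∃ (j : J) (x : (D.obj j).obj.obj X),
          (c.ι.app j).hom.app X x = f.hom.app X t) → ∃ g : T ⟶ U, g ≫ ι = f := by
  let S : Subfunctor c.pt.obj :=
    { obj := fun X => {u | ∃ (j : J) (x : (D.obj j).obj.obj X), (c.ι.app j).hom.app X x = u}
      map := by
        rintro X Y i _ ⟨j, x, rfl⟩
        exact ⟨j, (D.obj j).obj.map i x, NatTrans.naturality_apply (c.ι.app j).hom i x⟩ }
  let l' (j : J) : (D.obj j).obj ⟶ S.toFunctor :=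
    Subfunctor.lift (c.ι.app j).hom (by rintro X _ ⟨x, rfl⟩; exact ⟨j, x, rfl⟩)
  have hl' (j : J) : l' j ≫ S.ι = (c.ι.app j).hom := rfl
  have hS : pureMono C S.ι := by
    -- A formula has finitely many parameters, so by filteredness they all come from one stage.
    refine pureMono.of_exists_lift _ fun n Γ a => ?_
    classical
    choose j x hx using fun i => (a i).2
    obtain ⟨k, hk⟩ := IsFiltered.sup_objs_exists (Finset.univ.image j)
    have hk' (i : Fin n) : Nonempty (j i ⟶ k) := hk (by simp)
    refine ⟨(D.obj k).obj, l' k, fun i => (D.map (hk' i).some).hom.app _ (x i),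
      hl' k ▸ (c.ι.app k).property, fun i => Subtype.ext ?_⟩
    rw [← hx i, ← c.w (hk' i).some]
    rfl
  refine ⟨⟨S.toFunctor⟩, ⟨S.ι, hS⟩,
    fun j => ⟨l' j, pureMono.of_comp (hl' j ▸ (c.ι.app j).property)⟩, fun j => rfl, ?_, ?_⟩
  · rintro X ⟨_, j, x, rfl⟩
    exact ⟨j, x, rfl⟩
  · intro T f hf
    let g : T.obj ⟶ S.toFunctor :=
      Subfunctor.lift f.hom (by rintro X _ ⟨t, rfl⟩; exact hf X t)
    have hg : g ≫ S.ι = f.hom := rfl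
    exact ⟨⟨g, pureMono.of_comp (hg ▸ f.property)⟩, rfl⟩

open Independence in
/-- Filtered colimits in the category of independent squares are jointly surjective on codomains. -/
theorem exists_right_app_eq {R : ObjectProperty (Square (PureCategory C))} [IsWeaklyStable R]
    {J : Type*} [Category J] [IsFiltered J] {D : J ⥤ IndepCategory R} {c : Cocone D}
    (hc : IsColimit c) (X : C) (n : c.pt.obj.right.obj.obj X) :
    ∃ (j : J) (x : (D.obj j).obj.right.obj.obj X), (c.ι.app j).hom.right.hom.app X x = n := by
  let F : IndepCategory R ⥤ Arrow (PureCategory C) := wideSubcategoryInclusion _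
  obtain ⟨M, ιM, lM, hlM, hM, -⟩ :=
    PureCategory.exists_union ((F ⋙ Arrow.leftFunc).mapCocone c)
  obtain ⟨N, ιN, lN, hlN, hN, liftN⟩ :=
    PureCategory.exists_union ((F ⋙ Arrow.rightFunc).mapCocone c)
  change M ⟶ c.pt.obj.left at ιM
  change N ⟶ c.pt.obj.right at ιN
  change ∀ j, (D.obj j).obj.left ⟶ M at lM
  change ∀ j, (D.obj j).obj.right ⟶ N at lN
  change ∀ j, lM j ≫ ιM = (c.ι.app j).hom.left at hlM
  change ∀ j, lN j ≫ ιN = (c.ι.app j).hom.right at hlN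
  have w (j : J) : (D.obj j).obj.hom ≫ (c.ι.app j).hom.right =
      (c.ι.app j).hom.left ≫ c.pt.obj.hom := (Arrow.w (c.ι.app j).hom).symm
  obtain ⟨h, hh⟩ := liftN M (ιM ≫ c.pt.obj.hom) fun Y m => by
    obtain ⟨j, x, rfl⟩ := hM Y m
    refine ⟨j, (D.obj j).obj.hom.hom.app Y x, ?_⟩
    have := w j
    rw [← hlM, Category.assoc] at this
    exact ConcreteCategory.congr_hom (congr_app (congrArg (fun θ => θ.hom) this) Y) x
  change h ≫ ιN = ιM ≫ c.pt.obj.hom at hh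
  have w' (j : J) : (D.obj j).obj.hom ≫ lN j = lM j ≫ h := by
    rw [← cancel_mono ιN, Category.assoc, Category.assoc, hlN, hh, w, ← hlM, Category.assoc]
  -- Monotonicity shrinks the side from the colimit's domain to `M`; invariance of independence in
  -- the corner then shrinks the corner to `N`.
  have hR (j : J) : R (Square.mk (D.obj j).obj.hom (lM j) (lN j) h (w' j)) := by
    have hj : R (Square.mk (D.obj j).obj.hom (c.ι.app j).hom.left (c.ι.app j).hom.right
      c.pt.obj.hom (w j)) := (c.ι.app j).property
    simp only [← hlM] at hj
    have hj' := IsWeaklyStable.monotone _ _ _ _ _ _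
      (by rw [w, ← hlM, Category.assoc]) hj
    refine (IsIndependenceRelation.extend_iff _ _ _ _ (w' j) ιN).2 ?_
    simp only [hlN, hh]
    exact hj'
  let c' : Cocone D :=
    { pt := ⟨Arrow.mk h⟩
      ι :=
        { app := fun j => ⟨Arrow.homMk (lM j) (lN j) (w' j).symm, hR j⟩
          naturality := fun i j f => by
            have hf := congrArg (fun θ => θ.hom) (c.w f)
            apply WideSubcategory.hom_ext
            apply Arrow.hom_ext
            · change (D.map f).hom.left ≫ lM j = lM i ≫ 𝟙 _
              rw [← cancel_mono ιM, Category.comp_id, Category.assoc, hlM, hlM]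
              exact congrArg (fun θ => θ.left) hf
            · change (D.map f).hom.right ≫ lN j = lN i ≫ 𝟙 _
              rw [← cancel_mono ιN, Category.comp_id, Category.assoc, hlN, hlN]
              exact congrArg (fun θ => θ.right) hf } }
  -- The universal property maps the colimit back into the union; being pure, `r` is injective, so
  -- the colimit has no elements beyond the images of the stages.
  let r : c.pt.obj.right ⟶ N := (hc.desc c').hom.right
  have hr (j : J) : (c.ι.app j).hom.right ≫ r = lN j :=
    congrArg (fun θ => θ.hom.right) (hc.fac c' j)
  obtain ⟨j, x, hx⟩ := hN X (r.hom.app X n)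
  refine ⟨j, x, PureCategory.hom_injective r X ?_⟩
  rw [← hx, ← hr]
  rfl

/-! ### Links in pure effective squares -/

/-- In a pure effective square, an element of `L₂` that is linked in `L` to an element of `L₁`
outside of `L₂` comes from `L₀`. -/
theorem IsPureEffective.exists_preimage {L₀ L₁ L₂ L : C ⥤ Type u} {f₁ : L₀ ⟶ L₁} {f₂ : L₀ ⟶ L₂}
    {g₁ : L₁ ⟶ L} {g₂ : L₂ ⟶ L} {h : f₁ ≫ g₁ = f₂ ≫ g₂} (hp : IsPureEffective f₁ f₂ g₁ g₂ h)
    {X Y Z : C} (hf₁ : Function.Injective (f₁.app X)) (f : Z ⟶ X) (g : Z ⟶ Y) (x : L₂.obj X)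
    (y : L₁.obj Y) (hy : ∀ y' : L₂.obj Y, g₂.app Y y' ≠ g₁.app Y y) (z : L.obj Z)
    (hzx : L.map f z = g₂.app X x) (hzy : L.map g z = g₁.app Y y) :
    ∃ s : L₀.obj X, f₂.app X s = x := by
  have hpo (W : C) : IsPushout (f₁.app W) (f₂.app W) ((pushout.inl f₁ f₂).app W)
      ((pushout.inr f₁ f₂).app W) :=
    (IsPushout.of_hasPushout f₁ f₂).map ((evaluation C (Type u)).obj W)
  have hinl {W : C} (t : L₁.obj W) : (pushout.desc g₁ g₂ h).app W ((pushout.inl f₁ f₂).app W t) =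
      g₁.app W t :=
    ConcreteCategory.congr_hom (congr_app (pushout.inl_desc g₁ g₂ h) W) t
  have hinr {W : C} (t : L₂.obj W) : (pushout.desc g₁ g₂ h).app W ((pushout.inr f₁ f₂).app W t) =
      g₂.app W t :=
    ConcreteCategory.congr_hom (congr_app (pushout.inr_desc g₁ g₂ h) W) t
  obtain ⟨p, hpx, hpy⟩ := pureMono.exists_link hp f g ((pushout.inr f₁ f₂).app X x)
    ((pushout.inl f₁ f₂).app Y y) z (by rw [hzx, hinr]) (by rw [hzy, hinl])
  -- Purity has moved the link into the pushout, where its witness lies on one side. From `L₁`, it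
  -- puts `x` in the overlap `L₀`; from `L₂`, it would put `y` in `L₂`.
  obtain ⟨z₁, rfl⟩ | ⟨z₂, rfl⟩ := Types.eq_or_eq_of_isPushout (hpo Z) p
  · rw [← NatTrans.naturality_apply] at hpx
    obtain ⟨s, -, hs⟩ := (Types.pushoutCocone_inl_eq_inr_iff_of_isColimit (hpo X).isColimit hf₁
      (L₁.map f z₁) x).1 hpx
    exact ⟨s, hs⟩
  · rw [← NatTrans.naturality_apply] at hpy
    exact absurd (by rw [← hinr, hpy, hinl]) (hy (L₂.map g z₂))

/-! ### Powers, diagonals and the cardinality contradiction -/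

/-- The power of a presheaf by a set. -/
def power (K : C ⥤ Type u) (I : Type u) : C ⥤ Type u where
  obj X := I → K.obj X
  map f := ↾fun s i => K.map f (s i)

/-- The diagonal map into a power. -/
def diagonal (K : C ⥤ Type u) (I : Type u) : K ⟶ power K I where
  app X := ↾fun x _ => x

/-- Evaluation of a power at an index. -/
def powerEval (K : C ⥤ Type u) {I : Type u} (i : I) : power K I ⟶ K where
  app X := ↾fun s => s i

theorem pureMono_diagonal (K : C ⥤ Type u) (I : Type u) [Nonempty I] :
    pureMono C (diagonal K I) :=
  pureMono.of_split (r := powerEval K (Classical.arbitrary I)) rfl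

end Presheaf

open Presheaf Independence in
theorem mainTheorem6 {C : Type u} [SmallCategory.{u} C]
    (hstable : Independence.IsStable.{u} (Presheaf.pureEffective C)) :
    ¬ ∃ K : C ⥤ Type u, Presheaf.InterpretsCompleteBipartite K := by
  rintro ⟨K, X, Y, Z, f, g, A, B, hA, hB, hAB⟩
  obtain ⟨a₀, ha₀, a₁, ha₁, ha⟩ := hA.nontrivial
  obtain ⟨b₀, hb₀, b₁, hb₁, hb⟩ := hB.nontrivial
  obtain ⟨κ, _, _⟩ := hstable.accessible.exists_cardinal
  obtain ⟨P, _, hP⟩ := HasCardinalFilteredGenerator.exists_small_generator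
    (IndepCategory (pureEffective C)) κ
  let e := equivShrink.{u} (Subtype P)
  -- The sum embeds the `X`-sort of each generator's domain in `I`; `none` keeps `I` nonempty, so
  -- that `b` below is not diagonal.
  let I : Type u := Option (Σ p : Shrink.{u} (Subtype P), (e.symm p).1.obj.left.obj.obj X)
  let M : PureCategory C := ⟨power K I⟩
  let N : PureCategory C := ⟨power (power K I) (ULift.{u} Bool)⟩
  let δ : M ⟶ N := ⟨diagonal _ _, pureMono_diagonal _ _⟩
  obtain ⟨J, _, _, ⟨hJ⟩⟩ := hP.exists_colimitsOfShape ⟨Arrow.mk δ⟩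
  have := isFiltered_of_isCardinalFiltered J κ
  let b : N.obj.obj Y := fun t _ => if t.down then b₁ else b₀
  obtain ⟨j, n, hn⟩ := exists_right_app_eq hJ.isColimit Y b
  let q : Shrink.{u} (Subtype P) := e ⟨_, hJ.prop_diag_obj j⟩
  have key (s : I → Prop) : ∃ m : (hJ.diag.obj j).obj.left.obj.obj X,
      (hJ.ι.app j).hom.left.hom.app X m = fun i => open Classical in if s i then a₁ else a₀ := by
    classical
    have hs (t : ULift.{u} Bool) (i : I) := hAB (if s i then a₁ else a₀)
      (by split_ifs <;> assumption) (if t.down then b₁ else b₀) (by split_ifs <;> assumption)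
    choose z hzx hzy using hs
    refine IsPureEffective.exists_preimage (hJ.ι.app j).property
      (PureCategory.hom_injective (hJ.diag.obj j).obj.hom X) f g _ n (fun y' hy' => hb ?_) z ?_ ?_
    · have h₀ : (fun _ => y') = b := hy'.trans hn
      have h₁ : y' none = b₀ := congrFun (congrFun h₀ ⟨false⟩) none
      have h₂ : y' none = b₁ := congrFun (congrFun h₀ ⟨true⟩) none
      exact h₁.symm.trans h₂
    · funext t i
      exact hzx t i
    · refine Eq.trans ?_ hn.symm
      funext t i
      exact hzy t i
  obtain ⟨ψ, hψ⟩ : ∃ ψ : (e.symm q).1.obj.left.obj.obj X → I → K.obj X,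
      ∀ s : I → Prop, ∃ m, ψ m = fun i => open Classical in if s i then a₁ else a₀ := by
    rw [show e.symm q = ⟨_, hJ.prop_diag_obj j⟩ from e.symm_apply_apply _]
    exact ⟨_, key⟩
  -- Restricting the families to the copy of the domain inside `I` makes every subset of the domain
  -- the value of one of its elements.
  refine Function.cantor_surjective (fun m => {m' | ψ m (some ⟨q, m'⟩) = a₁}) fun S => ?_
  obtain ⟨m, hm⟩ := hψ fun i => ∃ m' ∈ S, i = some ⟨q, m'⟩
  refine ⟨m, Set.ext fun m' => ?_⟩
  have hS : (∃ m'' ∈ S, some (⟨q, m'⟩ : Σ p, (e.symm p).1.obj.left.obj.obj X) = some ⟨q, m''⟩) ↔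
      m' ∈ S := by
    refine ⟨?_, fun h => ⟨m', h, rfl⟩⟩
    rintro ⟨m'', h, h'⟩
    rwa [eq_of_heq (Sigma.mk.inj (Option.some.inj h')).2]
  simp only [Set.mem_ofPred_eq, hm, ← hS]
  split_ifs with h
  · exact iff_of_true rfl h
  · exact iff_of_false ha h
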